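/- Let $n \ge 2$ and let $X = \operatorname{Bl}_{\mathrm{pt}}\mathbb{P}^n$ be the blowup of $\mathbb{P}^n$ at a point, with $H$ the pullback of the hyperplane class and $E$ the exceptional divisor. Put $T_n = \tan(\pi/n)$, with $T_2 = +\infty$. For a real number $p \in (-T_n, T_n)\setminus\{0\}$ define $$\hat\theta = \arctan\left(\frac{\operatorname{Im}(1-(1+\operatorname{i}p)^n)}{\operatorname{Re}(1-(1+\operatorname{i}p)^n)}\right) \ (p<0), \qquad \hat\theta = \arctan\left(\frac{\operatorname{Im}(1-(1+\operatorname{i}p)^n)}{\operatorname{Re}(1-(1+\operatorname{i}p)^n)}\right) + \pi \ (p>0),$$ $$a = \left(\sin(\hat\theta)\,\cos\left(\tfrac{\hat\theta-\pi/2}{n-1}\right)^{n-1}\right)^{-1/n},\qquad q = \tan\left(\tfrac{\hat\theta-\pi/2}{n-1}\right),$$ and consider the $\mathbb{R}$-divisors ($\mathbb{R}$-line bundles) $$L_1 = -apH+qE,\qquad L_2 = qE .$$ For $b>0$ close to $1$ let $\omega_{a,b}$ be a form with Calabi symmetry in the class $aH-bE$ (that is, $\omega_{a,b} = \frac{\operatorname{i}}{2\pi}\partial\bar\partial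 u(\log|z|^2)$ on $\mathbb{C}^n\setminus\{0\}\cong X\setminus(H\cup E)$ for some function $u$; for instance a Kähler form of this type). For a shifted $\mathbb{R}$-line bundle $L$ let $$Z(L) = \int_X(\omega_{a,b}+\operatorname{i}c_1(L))^n,\qquad Z(L[1]) = -Z(L),\qquad \lambda(L) = \frac{\operatorname{Im}Z(L)}{\operatorname{Re}Z(L)},$$ where $c_1(L)$ is represented by the Chern form of any Hermitian metric on $L$ with Calabi symmetry, and let $\arg$ be the principal argument, with values in $(-\pi,\pi]$. (i) Suppose $p\in(-T_n,0)$. For all $b$ sufficiently close to $1$ (depending on $n$ and $p$ only), we have $\operatorname{Re}Z(L_1)\ne0$ and $\operatorname{Re}Z(L_2)\neq 0$, and $b<1$ if and only if $\lambda(L_1)<\lambda(L_2)$. Moreover, $Z(L_1)$ and $Z(L_2[1])$ lie in the upper half plane $\{\operatorname{Im}>0\}$, and $b<1$ if and only if $\arg Z(L_1)<\arg Z(L_2[1])$. (ii) Suppose $p\in(0,T_n)$. For all $b$ sufficiently close to $1$ (depending on $n$ and $p$ only), we have $\operatorname{Re}Z(L_1)\ne0$ and $\operatorname{Re}Z(L_2)\neq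 0$, and $b<1$ if and only if $\lambda(L_2)<\lambda(L_1)$. Moreover, $Z(L_2)$ and $Z(L_1[1])$ lie in the upper half plane, and $b<1$ if and only if $\arg Z(L_2)<\arg Z(L_1[1])$. -/

import Mathlib

open scoped ContDiff Topology

/-! ### The blowup of projective space at a point -/

/-- `Bl_p ℙⁿ` for the point `p = [1 : 0 : … : 0]` of `ℙⁿ`, as the incidence variety of the pairs
`([w₀ : w], [ζ]) ∈ ℙⁿ × ℙⁿ⁻¹` with `wᵢ ζⱼ = wⱼ ζᵢ` for all `i, j`. -/
def BlowUp (n : ℕ) : Type :=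
  {x : Projectivization ℂ (Fin (n + 1) → ℂ) × Projectivization ℂ (Fin n → ℂ) //
    ∀ i j : Fin n, x.1.rep i.succ * x.2.rep j = x.1.rep j.succ * x.2.rep i}

namespace BlowUp

variable {n : ℕ}

theorem cons_ne_zero (t s : ℂ) (ζ : Fin n → ℂ) (hst : t ≠ 0 ∨ s ≠ 0) (hζ : ζ ≠ 0) :
    (Fin.cons t (s • ζ) : Fin (n + 1) → ℂ) ≠ 0 := by
  intro h
  have h0 : t = 0 := by simpa using congrFun h 0
  have hs : s ≠ 0 := hst.resolve_left (fun h' => h' h0)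
  apply hζ
  funext i
  have hi : s = 0 ∨ ζ i = 0 := by simpa using congrFun h i.succ
  exact hi.resolve_left hs

/-- The point `([t : s ζ], [ζ])`. The exceptional divisor `E` is the locus `s = 0`, and the
pulled back hyperplane `H` (at infinity) is the locus `t = 0`. -/
noncomputable def point (t s : ℂ) (ζ : Fin n → ℂ) (hst : t ≠ 0 ∨ s ≠ 0) (hζ : ζ ≠ 0) :
    BlowUp n :=
  ⟨(Projectivization.mk ℂ (Fin.cons t (s • ζ)) (cons_ne_zero t s ζ hst hζ),
    Projectivization.mk ℂ ζ hζ), by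
    intro i j
    obtain ⟨c, hc⟩ := Projectivization.exists_smul_eq_mk_rep ℂ
      (Fin.cons t (s • ζ) : Fin (n + 1) → ℂ) (cons_ne_zero t s ζ hst hζ)
    obtain ⟨d, hd⟩ := Projectivization.exists_smul_eq_mk_rep ℂ ζ hζ
    simp only [← hc, ← hd, Pi.smul_apply, Fin.cons_succ, Units.smul_def, smul_eq_mul]
    ring⟩

theorem update_ne_zero (j : Fin n) (w : Fin n → ℂ) : Function.update w j 1 ≠ 0 := by
  intro h
  simpa using congrFun h j

/-- The holomorphic chart `ℂⁿ → Bl_p ℙⁿ` with `t = 1`, `ζⱼ = 1` and coordinates `s = wⱼ`,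
`ζᵢ = wᵢ` for `i ≠ j`. The divisor `E` has the local equation `wⱼ = 0`, and `H` is
disjoint from the chart. -/
noncomputable def chartE (j : Fin n) (w : Fin n → ℂ) : BlowUp n :=
  point 1 (w j) (Function.update w j 1) (Or.inl one_ne_zero) (update_ne_zero j w)

/-- The holomorphic chart `ℂⁿ → Bl_p ℙⁿ` with `s = 1`, `ζⱼ = 1` and coordinates `t = wⱼ`,
`ζᵢ = wᵢ` for `i ≠ j`. The divisor `H` has the local equation `wⱼ = 0`, and `E` is
disjoint from the chart. The charts `chartE j` and `chartH j` together form an atlas. -/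
noncomputable def chartH (j : Fin n) (w : Fin n → ℂ) : BlowUp n :=
  point (w j) 1 (Function.update w j 1) (Or.inr one_ne_zero) (update_ne_zero j w)

/-- The identification `ℂⁿ ∖ {0} ≅ Bl_p ℙⁿ ∖ (H ∪ E)`, `z ↦ ([1 : z], [z])`. -/
noncomputable def openPoint (z : Fin n → ℂ) (hz : z ≠ 0) : BlowUp n :=
  point 1 1 z (Or.inl one_ne_zero) hz

/-! ### Hermitian metrics on `ℝ`-line bundles and their Chern forms -/

/-- `φ` is the weight of a smooth Hermitian metric on the `ℝ`-line bundle `O(x H + y E)`, that is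
`φ = - log |σ|²` off `H ∪ E`, where `σ` is the canonical section with divisor `x H + y E`:
in every chart `φ` is smooth up to subtracting `y log |s|²` resp. `x log |t|²`, with `s`, `t` the
local equations of `E`, `H`. The values of `φ` on `H ∪ E` play no role. -/
def IsMetricWeight (x y : ℝ) (φ : BlowUp n → ℝ) : Prop :=
  ∀ j : Fin n,
    (∃ g : (Fin n → ℂ) → ℝ, ContDiff ℝ ∞ g ∧
      ∀ w : Fin n → ℂ, w j ≠ 0 → φ (chartE j w) = g w - y * Real.log (‖w j‖ ^ 2)) ∧
    (∃ g : (Fin n → ℂ) → ℝ, ContDiff ℝ ∞ g ∧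
      ∀ w : Fin n → ℂ, w j ≠ 0 → φ (chartH j w) = g w - x * Real.log (‖w j‖ ^ 2))

/-- Calabi symmetry: on `ℂⁿ ∖ {0} ≅ Bl_p ℙⁿ ∖ (H ∪ E)` the weight is a function of `log |z|²`. -/
def HasCalabiSymmetry (φ : BlowUp n → ℝ) : Prop :=
  ∃ u : ℝ → ℝ, ∀ (z : Fin n → ℂ) (hz : z ≠ 0),
    φ (openPoint z hz) = u (Real.log (∑ i, ‖z i‖ ^ 2))

/-- The Wirtinger derivative `∂f / ∂zⱼ`. -/
noncomputable def wirtinger (j : Fin n) (f : (Fin n → ℂ) → ℂ) (z : Fin n → ℂ) : ℂ :=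
  (fderiv ℝ f z (Pi.single j 1) - Complex.I * fderiv ℝ f z (Pi.single j Complex.I)) / 2

/-- The Wirtinger derivative `∂f / ∂z̄ⱼ`. -/
noncomputable def wirtingerBar (j : Fin n) (f : (Fin n → ℂ) → ℂ) (z : Fin n → ℂ) : ℂ :=
  (fderiv ℝ f z (Pi.single j 1) + Complex.I * fderiv ℝ f z (Pi.single j Complex.I)) / 2

open Classical in
/-- The function `φ` in the coordinates `z` on `ℂⁿ ∖ {0} ≅ Bl_p ℙⁿ ∖ (H ∪ E)` (and `0` at the
irrelevant point `z = 0`). -/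
noncomputable def inCoord (φ : BlowUp n → ℝ) (z : Fin n → ℂ) : ℂ :=
  if hz : z ≠ 0 then (φ (openPoint z hz) : ℂ) else 0

/-- The matrix `(∂² φ / ∂zⱼ ∂z̄ₖ)`, that is the coefficient matrix of the Chern form
`(i / 2π) ∂∂̄ φ = (i / 2π) ∑ φ_{j k̄} dzⱼ ∧ dz̄ₖ` of the metric with weight `φ`. For a metric on
`O(x H + y E)` this closed form represents the class `x H + y E = c₁(O(x H + y E))`. -/
noncomputable def chernMatrix (φ : BlowUp n → ℝ) (z : Fin n → ℂ) : Matrix (Fin n) (Fin n) ℂ :=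
  Matrix.of fun j k => wirtinger j (wirtingerBar k (inCoord φ)) z

/-- The integral `∫_{Bl_p ℙⁿ} Θⁿ` of the top power of `Θ = (i / 2π) ∑ Θ_{j k̄} dzⱼ ∧ dz̄ₖ`. Here
`Θⁿ = n! (i / 2π)ⁿ det(Θ) dz₁ ∧ dz̄₁ ∧ … ∧ dzₙ ∧ dz̄ₙ = (n! / πⁿ) det(Θ) dV`, with `dV` the Lebesgue
measure, and `H ∪ E`, the complement of `ℂⁿ ∖ {0}`, has measure zero. -/
noncomputable def integralTopPower (Θ : (Fin n → ℂ) → Matrix (Fin n) (Fin n) ℂ) : ℂ :=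
  ((n.factorial : ℂ) / (Real.pi : ℂ) ^ n) * ∫ z : Fin n → ℂ, (Θ z).det

end BlowUp

/-- A shifted `ℝ`-line bundle `O(x H + y E)[k]` on `Bl_p ℙⁿ`. -/
structure ShiftedRLineBundle where
  /-- the coefficient of `H` -/
  coeffH : ℝ
  /-- the coefficient of `E` -/
  coeffE : ℝ
  /-- the shift -/
  deg : ℤ

/-- The shift `L[1]`. -/
def ShiftedRLineBundle.shift (L : ShiftedRLineBundle) : ShiftedRLineBundle :=
  ⟨L.coeffH, L.coeffE, L.deg + 1⟩

/-- `φ` is the weight of a Calabi-symmetric Hermitian metric on `O(x H + y E)`; the Calabi-symmetric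
representatives of the class `x H + y E` are the Chern forms `(i / 2π) ∂∂̄ φ`. -/
def IsCalabiWeight (n : ℕ) (x y : ℝ) (φ : BlowUp n → ℝ) : Prop :=
  BlowUp.IsMetricWeight x y φ ∧ BlowUp.HasCalabiSymmetry φ

/-- The central charge `Z(L) = ∫_X (ω + i c₁(L))ⁿ` on `X = Bl_p ℙⁿ`, with `Z(L[1]) = - Z(L)`, where
`ω = (i / 2π) ∂∂̄ φ`, and `c₁(L)` is represented by `(i / 2π) ∂∂̄ ψ` for the weight `ψ` of a metric on
(the unshifted bundle underlying) `L`. -/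
noncomputable def centralCharge {n : ℕ} (φ : BlowUp n → ℝ) (L : ShiftedRLineBundle)
    (ψ : BlowUp n → ℝ) : ℂ :=
  (-1) ^ L.deg *
    BlowUp.integralTopPower
      (fun z => BlowUp.chernMatrix φ z + Complex.I • BlowUp.chernMatrix ψ z)

/-- The slope `λ = Im Z / Re Z`. -/
noncomputable def zSlope (Z : ℂ) : ℝ := Z.im / Z.re

/-! ### The parameters attached to `p` -/

/-- The Lagrangian phase angle `θ̂`, the argument in `(0, π)`, modulo `π`, of `1 - (1 + i p)ⁿ`: it is
`arctan (Im / Re)` for `p < 0`, and `arctan (Im / Re) + π` for `p > 0`. -/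
noncomputable def phaseAngle (n : ℕ) (p : ℝ) : ℝ :=
  Real.arctan ((1 - (1 + Complex.I * p) ^ n).im / (1 - (1 + Complex.I * p) ^ n).re) +
    if 0 < p then Real.pi else 0

/-- The Kähler parameter
`a = (sin θ̂ · cos ((θ̂ - π / 2) / (n - 1)) ^ (n - 1)) ^ (- 1 / n)`. -/
noncomputable def kahlerParam (n : ℕ) (p : ℝ) : ℝ :=
  (Real.sin (phaseAngle n p) *
    Real.cos ((phaseAngle n p - Real.pi / 2) / ((n : ℝ) - 1)) ^ (n - 1)) ^ (-(1 / (n : ℝ)))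

/-- The critical point `q = tan ((θ̂ - π / 2) / (n - 1))`. -/
noncomputable def critPoint (n : ℕ) (p : ℝ) : ℝ :=
  Real.tan ((phaseAngle n p - Real.pi / 2) / ((n : ℝ) - 1))

/-- `L₁ = - a p H + q E`. -/
noncomputable def lineBundleOne (n : ℕ) (p : ℝ) : ShiftedRLineBundle :=
  ⟨-(kahlerParam n p * p), critPoint n p, 0⟩

/-- `L₂ = q E`. -/
noncomputable def lineBundleTwo (n : ℕ) (p : ℝ) : ShiftedRLineBundle :=
  ⟨0, critPoint n p, 0⟩

/-!
A Calabi-symmetric weight on `O(x H + y E)` is a function `u(t)` of `t = log |z|²`, and smoothness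
across `E` and `H` says that `u(t) + y t` and `u(t) - x t` are smooth functions of `e^(t/2)` and of
`e^(-t/2)`. Hence the momentum profile `V = u'` tends to `-y` at `-∞` and to `x` at `+∞`, with
integrable derivative (`IsCalabiWeight.exists_momentumProfile`). The determinant of the Chern form is
`V^(n-1) V' / |z|^(2n)` (`det_chernMatrix_add`, also for complex combinations), and integration in
polar coordinates turns its integral into that of the derivative of `Vⁿ`. This gives the
intersection numbers `∫ (ω + i c₁(L))ⁿ = (a + i x)ⁿ - (b - i y)ⁿ` (`integralTopPower_eq`).

The remaining problem is planar. The case `p > 0` is the complex conjugate of the case `-p`, so let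
`p = - tan β < 0`, `1 - (1 + i p)ⁿ = c exp (i θ)` with `0 < θ < π / 2`, and
`α = (θ - π / 2) / (n - 1)`. The parameters `a` and `q = tan α` are such that at `b = 1` both
conjugate charges lie on the line `ℝ exp (i θ)`: the one of `L₂` equals `κ exp (i θ)`, and the one of
`L₁` equals `(κ - aⁿ c) exp (i θ)`. Here `0 < κ < aⁿ c`; the second inequality amounts to `-β < α`,
that is `pi_div_two_sub_lt`. As `b` moves, the difference of the two charges is constant, so
they rotate relative to each other according to the side of the line `ℝ exp (i θ)` on which the
second one lies, and the derivative `n (1 + i q)^(n-1)` is perpendicular to that line, so that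
the side changes exactly at `b = 1` (`eventually_position_conjCharge`).
-/

/-! ### Wirtinger calculus for functions of `|z|²` -/

namespace BlowUp

variable {n : ℕ}

/-- The squared Euclidean norm `|z|²` on `ℂⁿ` (the norm of `Fin n → ℂ` is the sup norm). -/
noncomputable def radiusSq (z : Fin n → ℂ) : ℝ := ∑ i, ‖z i‖ ^ 2

theorem radiusSq_pos {z : Fin n → ℂ} (hz : z ≠ 0) : 0 < radiusSq z := by
  obtain ⟨i, hi⟩ := Function.ne_iff.mp hz
  refine Finset.sum_pos' (fun _ _ => by positivity) ⟨i, Finset.mem_univ i, ?_⟩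
  have : z i ≠ 0 := hi
  positivity

theorem star_dotProduct_self (z : Fin n → ℂ) : star z ⬝ᵥ z = (radiusSq z : ℂ) := by
  simp [dotProduct, radiusSq, Complex.conj_mul']

theorem hasFDerivAt_radiusSq (z : Fin n → ℂ) :
    HasFDerivAt radiusSq
      (∑ i, 2 • (innerSL ℝ (z i)).comp (ContinuousLinearMap.proj (R := ℝ) i)) z := by
  unfold radiusSq
  refine HasFDerivAt.fun_sum fun i _ => ?_
  exact (ContinuousLinearMap.proj (R := ℝ) (φ := fun _ : Fin n => ℂ) i).hasFDerivAt.norm_sq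

theorem radiusSq_deriv_single (z : Fin n → ℂ) (j : Fin n) (c : ℂ) :
    (∑ i, 2 • (innerSL ℝ (z i)).comp (ContinuousLinearMap.proj (R := ℝ) i) :
      (Fin n → ℂ) →L[ℝ] ℝ) (Pi.single j c) = 2 * (star (z j) * c).re := by
  rw [sum_apply, Finset.sum_eq_single j]
  · simp [Complex.inner]; ring
  · intro i _ hi
    simp [hi]
  · simp

theorem wirtingerBar_comp_radiusSq {F : ℝ → ℂ} {F' : ℂ} {z : Fin n → ℂ} (k : Fin n)
    (hF : HasDerivAt F F' (radiusSq z)) :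
    wirtingerBar k (fun w => F (radiusSq w)) z = F' * z k := by
  have h : HasFDerivAt (fun w => F (radiusSq w)) _ z :=
    hF.hasFDerivAt.comp z (hasFDerivAt_radiusSq z)
  rw [wirtingerBar, h.fderiv]
  simp only [ContinuousLinearMap.comp_apply, radiusSq_deriv_single,
    ContinuousLinearMap.toSpanSingleton_apply]
  apply Complex.ext <;> simp <;> ring

theorem wirtinger_comp_radiusSq_mul {F : ℝ → ℂ} {F' : ℂ} {z : Fin n → ℂ} (j k : Fin n)
    (hF : HasDerivAt F F' (radiusSq z)) :
    wirtinger j (fun w => F (radiusSq w) * w k) z =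
      F' * (star (z j) * z k) + F (radiusSq z) * (1 : Matrix (Fin n) (Fin n) ℂ) j k := by
  have h : HasFDerivAt (fun w => F (radiusSq w)) _ z :=
    hF.hasFDerivAt.comp z (hasFDerivAt_radiusSq z)
  have h' := h.mul (ContinuousLinearMap.proj (R := ℝ) (φ := fun _ : Fin n => ℂ) k).hasFDerivAt
  rw [wirtinger]
  erw [h'.fderiv]
  simp only [ContinuousLinearMap.comp_apply, radiusSq_deriv_single,
    ContinuousLinearMap.toSpanSingleton_apply, add_apply,
    smul_apply, ContinuousLinearMap.proj_apply]
  by_cases hjk : j = k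
  · subst hjk
    apply Complex.ext <;> simp <;> ring
  · have hkj : k ≠ j := Ne.symm hjk
    simp only [Pi.single_eq_of_ne hkj, Matrix.one_apply_ne hjk]
    apply Complex.ext <;> simp <;> ring

/-- The complex Hessian of `u (log |z|²)`, with `V = u'`. -/
theorem chernMatrix_eq {φ : BlowUp n → ℝ} {u V V' : ℝ → ℝ}
    (hφ : ∀ (z : Fin n → ℂ) (hz : z ≠ 0), φ (openPoint z hz) = u (Real.log (radiusSq z)))
    (hu : ∀ t, HasDerivAt u (V t) t) (hV : ∀ t, HasDerivAt V (V' t) t)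
    {z : Fin n → ℂ} (hz : z ≠ 0) :
    chernMatrix φ z =
      ((V (Real.log (radiusSq z)) / radiusSq z : ℝ) : ℂ) • (1 : Matrix (Fin n) (Fin n) ℂ) +
      (((V' (Real.log (radiusSq z)) - V (Real.log (radiusSq z))) / radiusSq z ^ 2 : ℝ) : ℂ) •
        Matrix.vecMulVec (star z) z := by
  have hne : ∀ᶠ w in 𝓝 z, w ≠ 0 := isOpen_ne.mem_nhds hz
  have first (k : Fin n) {w : Fin n → ℂ} (hw : w ≠ 0) :
      wirtingerBar k (inCoord φ) w =
        ((V (Real.log (radiusSq w)) / radiusSq w : ℝ) : ℂ) * w k := by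
    have hev : inCoord φ =ᶠ[𝓝 w] fun w => ((u (Real.log (radiusSq w)) : ℝ) : ℂ) := by
      filter_upwards [isOpen_ne.mem_nhds hw] with w' hw'
      have hw'' : w' ≠ 0 := hw'
      simp [inCoord, hw'', hφ]
    have hd := ((hu _).comp (radiusSq w) (Real.hasDerivAt_log (radiusSq_pos hw).ne')).ofReal_comp
    have := wirtingerBar_comp_radiusSq k hd
    unfold wirtingerBar at this ⊢
    rw [hev.fderiv_eq]
    simpa [div_eq_mul_inv] using this
  ext j k
  have hev : wirtingerBar k (inCoord φ) =ᶠ[𝓝 z]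
      fun w => ((V (Real.log (radiusSq w)) / radiusSq w : ℝ) : ℂ) * w k := by
    filter_upwards [hne] with w hw using first k hw
  have hr := radiusSq_pos hz
  have hd := (((hV _).comp (radiusSq z) (Real.hasDerivAt_log hr.ne')).div
    (hasDerivAt_id _) hr.ne').ofReal_comp
  have := wirtinger_comp_radiusSq_mul j k hd
  simp only [chernMatrix, Matrix.of_apply]
  unfold wirtinger at this ⊢
  rw [hev.fderiv_eq]
  refine this.trans ?_
  simp only [Matrix.add_apply, Matrix.smul_apply, Matrix.vecMulVec_apply, smul_eq_mul,
    Pi.star_apply, Function.comp, id]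
  rw [add_comm]
  congr 3
  have := hr.ne'
  field_simp

/-- The matrix determinant lemma in a form that does not need `c ≠ 0`, from the characteristic
polynomial of a rank one matrix. -/
theorem det_smul_one_add_smul_vecMulVec (c d : ℂ) (u v : Fin n → ℂ) :
    (c • (1 : Matrix (Fin n) (Fin n) ℂ) + d • Matrix.vecMulVec u v).det =
      c ^ n + d * (u ⬝ᵥ v) * c ^ (n - 1) := by
  have h := Matrix.eval_charpoly (Matrix.vecMulVec (-(d • u)) v) c
  rw [Matrix.charpoly_vecMulVec] at h
  have e : Matrix.scalar (Fin n) c - Matrix.vecMulVec (-(d • u)) v =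
      c • (1 : Matrix (Fin n) (Fin n) ℂ) + d • Matrix.vecMulVec u v := by
    rw [Matrix.neg_vecMulVec, Matrix.smul_vecMulVec, sub_neg_eq_add, Matrix.scalar_apply,
      Matrix.smul_one_eq_diagonal]
  rw [← e, ← h]
  simp

/-- The eigenvalues of the Chern form are `V / |z|²`, with multiplicity `n - 1` on the complex
tangent space of the spheres, and `V' / |z|²` in the radial direction. This holds for the complex
combination of two profiles, too, and is proved without dividing by `V`. -/
theorem det_chernMatrix_add {φ ψ : BlowUp n → ℝ} {u V V' u₁ W W' : ℝ → ℝ} (hn : n ≠ 0)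
    (hφ : ∀ (z : Fin n → ℂ) (hz : z ≠ 0), φ (openPoint z hz) = u (Real.log (radiusSq z)))
    (hu : ∀ t, HasDerivAt u (V t) t) (hV : ∀ t, HasDerivAt V (V' t) t)
    (hψ : ∀ (z : Fin n → ℂ) (hz : z ≠ 0), ψ (openPoint z hz) = u₁ (Real.log (radiusSq z)))
    (hu₁ : ∀ t, HasDerivAt u₁ (W t) t) (hW : ∀ t, HasDerivAt W (W' t) t)
    {z : Fin n → ℂ} (hz : z ≠ 0) :
    (chernMatrix φ z + Complex.I • chernMatrix ψ z).det =
      (V (Real.log (radiusSq z)) + Complex.I * W (Real.log (radiusSq z))) ^ (n - 1) *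
        (V' (Real.log (radiusSq z)) + Complex.I * W' (Real.log (radiusSq z))) /
        (radiusSq z : ℂ) ^ n := by
  rw [chernMatrix_eq hφ hu hV hz, chernMatrix_eq hψ hu₁ hW hz]
  set t := Real.log (radiusSq z)
  have hr : (radiusSq z : ℂ) ≠ 0 := by exact_mod_cast (radiusSq_pos hz).ne'
  have := det_smul_one_add_smul_vecMulVec ((V t + Complex.I * W t) / radiusSq z)
    ((V' t + Complex.I * W' t - (V t + Complex.I * W t)) / (radiusSq z : ℂ) ^ 2) (star z) z
  rw [star_dotProduct_self] at this
  convert this using 1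
  · congr 1
    ext j k
    simp only [Matrix.add_apply, Matrix.smul_apply, smul_eq_mul]
    push_cast
    ring
  · obtain ⟨m, rfl⟩ := Nat.exists_eq_succ_of_ne_zero hn
    simp only [Nat.succ_eq_add_one, Nat.add_sub_cancel, div_pow]
    field_simp
    ring

/-! ### Integration in the variable `log |z|²` -/

open MeasureTheory in
/-- The pushforward of the measure `|z|⁻²ⁿ dV` under `log |z|²` is a multiple of the Lebesgue
measure on the line. -/
theorem integral_comp_log_radiusSq (hn : n ≠ 0) (F : ℝ → ℂ) :
    ∫ z : Fin n → ℂ, F (Real.log (radiusSq z)) / (radiusSq z : ℂ) ^ n =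
      ((Real.pi : ℂ) ^ n / ((n - 1).factorial : ℂ)) * ∫ t, F t := by
  let e : EuclideanSpace ℂ (Fin n) ≃L[ℝ] (Fin n → ℂ) :=
    PiLp.continuousLinearEquiv 2 ℝ fun _ : Fin n => ℂ
  let μ : Measure (EuclideanSpace ℂ (Fin n)) := (volume : Measure (Fin n → ℂ)).map e.symm
  have : μ.IsAddHaarMeasure := e.symm.isAddHaarMeasure_map volume
  have hnorm (z : Fin n → ℂ) : radiusSq z = ‖e.symm z‖ ^ 2 := by
    rw [EuclideanSpace.norm_sq_eq]; rfl
  have hball : μ.real (Metric.ball 0 1) = Real.pi ^ n / n.factorial := by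
    have hm : μ (Metric.ball 0 1) = volume {x : Fin n → ℂ | ∑ i, ‖x i‖ ^ (2 : ℝ) < 1} := by
      rw [Measure.map_apply e.symm.continuous.measurable measurableSet_ball]
      congr 1
      ext z
      have := hnorm z
      simp only [radiusSq] at this
      simp [this]
    rw [Measure.real, hm, Complex.volume_sum_rpow_lt_one _ one_le_two, ENNReal.toReal_ofReal]
    · norm_num [Real.Gamma_nat_eq_factorial, mul_div_assoc]
    · have : 0 < Real.Gamma (2 * (Fintype.card (Fin n) : ℝ) / 2 + 1) :=
        Real.Gamma_pos_of_pos (by positivity)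
      have : 0 < Real.Gamma (2 / 2 + 1) := Real.Gamma_pos_of_pos (by positivity)
      positivity
  have hfin : Module.finrank ℝ (EuclideanSpace ℂ (Fin n)) = 2 * n := by
    rw [e.toLinearEquiv.finrank_eq, Module.finrank_pi_fintype]
    simp [mul_comm]
  let f : ℝ → ℂ := fun s => F (Real.log (s ^ 2)) / ((s ^ 2 : ℝ) : ℂ) ^ n
  have hint : ∫ z : Fin n → ℂ, F (Real.log (radiusSq z)) / (radiusSq z : ℂ) ^ n =
      ∫ x, f ‖x‖ ∂μ := by
    refine Eq.trans ?_
      (integral_map_equiv e.symm.toHomeomorph.toMeasurableEquiv (fun x => f ‖x‖)).symm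
    simp only [hnorm]
    rfl
  have hexp : ∫ t, F t = ∫ s in Set.Ioi (0 : ℝ), (2 * s⁻¹) • F (Real.log (s ^ 2)) := by
    have := integral_image_eq_integral_abs_deriv_smul (f := fun s => Real.log (s ^ 2))
      (f' := fun s => 2 * s⁻¹) measurableSet_Ioi
      (fun s (hs : (0 : ℝ) < s) => by
        have h := ((hasDerivAt_pow 2 s).log (by positivity)).hasDerivWithinAt (s := Set.Ioi 0)
        have hr : 2 * s⁻¹ = ((2 : ℕ) : ℝ) * s ^ (2 - 1) / s ^ 2 := by
          have := hs.ne'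
          norm_num
          field_simp
        rw [hr]
        exact h) (fun s hs t ht h => by
          have hs : (0 : ℝ) < s := hs
          have ht : (0 : ℝ) < t := ht
          have := Real.log_injOn_pos (Set.mem_Ioi.2 (by positivity))
            (Set.mem_Ioi.2 (by positivity)) h
          exact (pow_left_inj₀ hs.le ht.le two_ne_zero).mp this) F
    have him : (fun s : ℝ => Real.log (s ^ 2)) '' Set.Ioi 0 = Set.univ := by
      refine Set.eq_univ_of_forall fun t => ⟨Real.exp (t / 2), Real.exp_pos _, ?_⟩
      simp
      ring
    rw [him, setIntegral_univ] at this
    rw [this]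
    refine setIntegral_congr_fun measurableSet_Ioi fun s (hs : (0 : ℝ) < s) => ?_
    have : |2 * s⁻¹| = 2 * s⁻¹ := abs_of_pos (by positivity)
    rw [this]
  have : Nontrivial (EuclideanSpace ℂ (Fin n)) :=
    Module.nontrivial_of_finrank_pos (R := ℝ) (by omega)
  rw [hint, integral_fun_norm_addHaar μ f, hball, hfin, hexp]
  have hcongr : ∫ s in Set.Ioi (0 : ℝ), s ^ (2 * n - 1) • f s =
      ∫ s in Set.Ioi (0 : ℝ), (1 / 2 : ℂ) * ((2 * s⁻¹) • F (Real.log (s ^ 2))) := by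
    refine setIntegral_congr_fun measurableSet_Ioi fun s (hs : (0 : ℝ) < s) => ?_
    have hs' : (s : ℂ) ≠ 0 := by exact_mod_cast hs.ne'
    obtain ⟨m, rfl⟩ := Nat.exists_eq_succ_of_ne_zero hn
    have : 2 * (m + 1) - 1 = 2 * m + 1 := by omega
    simp only [f, Nat.succ_eq_add_one, this, Complex.real_smul]
    push_cast
    field_simp
    ring
  rw [hcongr, MeasureTheory.integral_const_mul]
  obtain ⟨m, rfl⟩ := Nat.exists_eq_succ_of_ne_zero hn
  have : ((m.factorial : ℕ) : ℂ) ≠ 0 := by exact_mod_cast m.factorial_ne_zero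
  have h2 : ((m : ℂ) + 1) ≠ 0 := by exact_mod_cast m.succ_ne_zero
  simp only [Nat.succ_eq_add_one, Nat.add_sub_cancel, Nat.factorial_succ, nsmul_eq_mul,
    Complex.real_smul]
  push_cast
  field_simp

end BlowUp

/-! ### Momentum profiles of Calabi-symmetric metrics -/

theorem exists_abs_le_on_unitInterval {f : ℝ → ℝ} (hf : Continuous f) :
    ∃ C, 0 ≤ C ∧ ∀ s, 0 < s → s ≤ 1 → |f s| ≤ C := by
  obtain ⟨C, hC⟩ := isCompact_Icc.exists_bound_of_continuousOn (s := Set.Icc (0 : ℝ) 1)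
    hf.continuousOn
  refine ⟨|C|, abs_nonneg C, fun s h0 h1 => ?_⟩
  exact (hC s ⟨h0.le, h1⟩).trans (le_abs_self C)

/-- Asymptotics at the end `t → -∞` of a function `u` such that `u t + y t` is a smooth function
of `e ^ (t / 2)` up to the value `0` of the latter. -/
theorem deriv_asymptotics_of_eq_comp_exp {u f : ℝ → ℝ} {y : ℝ} (hf : ContDiff ℝ ∞ f)
    (hu : ∀ t, u t = f (Real.exp (t / 2)) - y * t) :
    (∀ t, HasDerivAt u (deriv u t) t) ∧ (∀ t, HasDerivAt (deriv u) (deriv (deriv u) t) t) ∧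
      Continuous (deriv (deriv u)) ∧ Filter.Tendsto (deriv u) Filter.atBot (𝓝 (-y)) ∧
      ∃ C, ∀ t ≤ 0, |deriv u t| ≤ C ∧ |deriv (deriv u) t| ≤ C * Real.exp (t / 2) := by
  have hsm : ContDiff ℝ ∞ u := by
    have : u = fun t => f (Real.exp (t / 2)) - y * t := funext hu
    rw [this]
    fun_prop
  have hf1 : ContDiff ℝ ∞ (deriv f) := by
    have := hf.iterate_deriv 1
    simpa using this
  have hf2 : ContDiff ℝ ∞ (deriv (deriv f)) := by
    have := hf.iterate_deriv 2
    simpa using this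
  have hu1 : ContDiff ℝ ∞ (deriv u) := by simpa using hsm.iterate_deriv 1
  have hu2 : ContDiff ℝ ∞ (deriv (deriv u)) := by simpa using hsm.iterate_deriv 2
  have hexp (t : ℝ) : HasDerivAt (fun t => Real.exp (t / 2)) (Real.exp (t / 2) / 2) t := by
    have := ((hasDerivAt_id' t).div_const 2).exp
    convert this using 1
    simp [div_eq_mul_inv]
  have hdiff {g : ℝ → ℝ} (hg : ContDiff ℝ ∞ g) (s : ℝ) : HasDerivAt g (deriv g s) s :=
    ((hg.differentiable (by simp)) s).hasDerivAt
  have e1 : deriv u = fun t => deriv f (Real.exp (t / 2)) * (Real.exp (t / 2) / 2) - y := by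
    funext t
    have h := ((hdiff hf (Real.exp (t / 2))).comp t (hexp t)).sub ((hasDerivAt_id t).const_mul y)
    have hu' : u = fun t => f (Real.exp (t / 2)) - y * t := funext hu
    rw [hu']
    refine h.deriv.trans ?_
    simp
  have e2 : deriv (deriv u) = fun t =>
      (deriv (deriv f) (Real.exp (t / 2)) * (Real.exp (t / 2) / 4) +
        deriv f (Real.exp (t / 2)) / 4) * Real.exp (t / 2) := by
    funext t
    have h := (((hdiff hf1 (Real.exp (t / 2))).comp t (hexp t)).mul
      ((hexp t).div_const 2)).sub_const y
    rw [e1]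
    refine h.deriv.trans ?_
    simp only [Function.comp]
    ring
  refine ⟨hdiff hsm, hdiff hu1, hu2.continuous, ?_, ?_⟩
  · rw [e1]
    have h0 : Filter.Tendsto (fun t : ℝ => Real.exp (t / 2)) Filter.atBot (𝓝 0) :=
      Real.tendsto_exp_atBot.comp (Filter.tendsto_id.atBot_div_const two_pos)
    have hc : Continuous fun s => deriv f s * (s / 2) - y := by
      have := hf1.continuous
      fun_prop
    have := (hc.tendsto 0).comp h0
    simpa [Function.comp_def] using this
  · obtain ⟨A, hA0, hA⟩ := exists_abs_le_on_unitInterval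
      (f := fun s => deriv f s * (s / 2) - y) (by have := hf1.continuous; fun_prop)
    obtain ⟨B, hB0, hB⟩ := exists_abs_le_on_unitInterval
      (f := fun s => deriv (deriv f) s * (s / 4) + deriv f s / 4)
      (by have := hf1.continuous; have := hf2.continuous; fun_prop)
    refine ⟨A + B, fun t ht => ?_⟩
    have hpos := Real.exp_pos (t / 2)
    have hle : Real.exp (t / 2) ≤ 1 := Real.exp_le_one_iff.mpr (by linarith)
    rw [e2, e1]
    have h1 := hA _ hpos hle
    have h2 := hB _ hpos hle
    refine ⟨by simp only at h1 ⊢; linarith, ?_⟩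
    simp only at h2 ⊢
    rw [abs_mul, abs_of_pos hpos]
    gcongr
    linarith

/-- `V` is the momentum profile `du / dt`, `t = log |z|²`, of a Calabi-symmetric weight `u` on
`O(x H + y E)`, and `V'` its derivative. The limits of `V` at `± ∞` are the degrees of the class
on a line in `H` and on a line in `E`. -/
structure IsMomentumProfile (x y : ℝ) (V V' : ℝ → ℝ) : Prop where
  hasDerivAt : ∀ t, HasDerivAt V (V' t) t
  tendsto_atBot : Filter.Tendsto V Filter.atBot (𝓝 (-y))
  tendsto_atTop : Filter.Tendsto V Filter.atTop (𝓝 x)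
  bounded : ∃ C, ∀ t, |V t| ≤ C
  integrable : MeasureTheory.Integrable V'

open MeasureTheory in
theorem integrable_of_exp_bounds {g : ℝ → ℝ} {C D : ℝ} (hg : Continuous g)
    (hbot : ∀ t ≤ 0, |g t| ≤ C * Real.exp (t / 2))
    (htop : ∀ t ≤ 0, |g (-t)| ≤ D * Real.exp (t / 2)) : Integrable g := by
  have h1 : IntegrableOn g (Set.Iic 0) := by
    refine Integrable.mono' ((integrableOn_exp_mul_Iic (a := 1 / 2) (by norm_num) 0).const_mul C)
      hg.aestronglyMeasurable ?_
    refine (ae_restrict_iff' measurableSet_Iic).mpr (Filter.Eventually.of_forall fun t ht => ?_)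
    have := hbot t ht
    rwa [Real.norm_eq_abs, show (1 / 2 : ℝ) * t = t / 2 by ring]
  have h2 : IntegrableOn g (Set.Ioi 0) := by
    refine Integrable.mono' ((integrableOn_exp_mul_Ioi (a := -(1 / 2)) (by norm_num) 0).const_mul D)
      hg.aestronglyMeasurable ?_
    refine (ae_restrict_iff' measurableSet_Ioi).mpr (Filter.Eventually.of_forall fun t ht => ?_)
    have ht' : 0 < t := ht
    have := htop (-t) (by linarith)
    rw [neg_neg] at this
    rwa [Real.norm_eq_abs, show -(1 / 2 : ℝ) * t = -t / 2 by ring]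
  have := h1.union h2
  rwa [Set.Iic_union_Ioi, integrableOn_univ] at this

namespace BlowUp

variable {n : ℕ}

theorem chartE_single (j : Fin n) {s : ℂ} (hs : s ≠ 0) :
    chartE j (Pi.single j s) = openPoint (Pi.single j s) (by simpa using hs) := by
  have hup : Function.update (Pi.single j s : Fin n → ℂ) j 1 = Pi.single j 1 := by
    ext i; by_cases h : i = j
    · subst h; simp
    · simp [h]
  refine Subtype.ext (Prod.ext ?_ ?_)
  · refine (Projectivization.mk_eq_mk_iff' ℂ _ _ _ _).mpr ⟨1, ?_⟩
    rw [hup]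
    ext i
    refine Fin.cases ?_ (fun i => ?_) i
    · simp
    · by_cases h : i = j
      · subst h; simp
      · simp [h]
  · refine (Projectivization.mk_eq_mk_iff' ℂ _ _ _ _).mpr ⟨s⁻¹, ?_⟩
    rw [hup, ← Pi.single_smul]
    simp [hs]

theorem chartH_single (j : Fin n) {s : ℂ} (hs : s ≠ 0) :
    chartH j (Pi.single j s) = openPoint (Pi.single j s⁻¹) (by simpa using hs) := by
  have hup : Function.update (Pi.single j s : Fin n → ℂ) j 1 = Pi.single j 1 := by
    ext i; by_cases h : i = j
    · subst h; simp
    · simp [h]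
  refine Subtype.ext (Prod.ext ?_ ?_)
  · refine (Projectivization.mk_eq_mk_iff' ℂ _ _ _ _).mpr ⟨s, ?_⟩
    rw [hup]
    ext i
    refine Fin.cases ?_ (fun i => ?_) i
    · simp
    · by_cases h : i = j
      · subst h; simp [hs]
      · simp [h]
  · refine (Projectivization.mk_eq_mk_iff' ℂ _ _ _ _).mpr ⟨s, ?_⟩
    rw [hup, ← Pi.single_smul]
    simp [hs]

theorem sum_norm_sq_single (j : Fin n) (s : ℂ) :
    ∑ i, ‖(Pi.single j s : Fin n → ℂ) i‖ ^ 2 = ‖s‖ ^ 2 := by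
  rw [Finset.sum_eq_single j] <;> simp +contextual

end BlowUp

open BlowUp in
/-- It is enough to look at a weight on one coordinate axis, where the charts are `s ↦ s eⱼ` near
`E` and `s ↦ s⁻¹ eⱼ` near `H`; taking `s = e ^ (± t / 2)` gives the behaviour at both ends. -/
theorem IsCalabiWeight.exists_momentumProfile {n : ℕ} (hn : n ≠ 0) {x y : ℝ} {φ : BlowUp n → ℝ}
    (h : IsCalabiWeight n x y φ) :
    ∃ u V V' : ℝ → ℝ,
      (∀ (z : Fin n → ℂ) (hz : z ≠ 0), φ (openPoint z hz) = u (Real.log (∑ i, ‖z i‖ ^ 2))) ∧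
      (∀ t, HasDerivAt u (V t) t) ∧ IsMomentumProfile x y V V' := by
  obtain ⟨hw, u, hu⟩ := h
  let j : Fin n := ⟨0, Nat.pos_of_ne_zero hn⟩
  obtain ⟨⟨g, hg, hgφ⟩, k, hk, hkφ⟩ := hw j
  have hsingle : ContDiff ℝ ∞ fun s : ℝ => (Pi.single j (s : ℂ) : Fin n → ℂ) := by
    refine contDiff_pi.mpr fun i => ?_
    by_cases hi : i = j
    · subst hi; simp only [Pi.single_eq_same]; exact Complex.ofRealCLM.contDiff
    · simpa [hi] using contDiff_const
  have hnorm (t : ℝ) : ‖((Real.exp t : ℝ) : ℂ)‖ = Real.exp t := by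
    rw [Complex.norm_real, Real.norm_eq_abs, abs_of_pos (Real.exp_pos t)]
  have hE (t : ℝ) : u t = g (Pi.single j ((Real.exp (t / 2) : ℝ) : ℂ)) - y * t := by
    have h0 : ((Real.exp (t / 2) : ℝ) : ℂ) ≠ 0 := by exact_mod_cast (Real.exp_pos _).ne'
    have h1 := hgφ (Pi.single j ((Real.exp (t / 2) : ℝ) : ℂ)) (by simp)
    rw [chartE_single j h0, hu, sum_norm_sq_single, Pi.single_eq_same, hnorm, Real.log_pow,
      Real.log_exp] at h1
    convert h1 using 2 <;> push_cast <;> ring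
  have hH (t : ℝ) : u (-t) = k (Pi.single j ((Real.exp (t / 2) : ℝ) : ℂ)) - x * t := by
    have h0 : ((Real.exp (t / 2) : ℝ) : ℂ) ≠ 0 := by exact_mod_cast (Real.exp_pos _).ne'
    have h1 := hkφ (Pi.single j ((Real.exp (t / 2) : ℝ) : ℂ)) (by simp)
    rw [chartH_single j h0, hu, sum_norm_sq_single, Pi.single_eq_same, norm_inv, inv_pow,
      Real.log_inv, hnorm, Real.log_pow, Real.log_exp] at h1
    convert h1 using 2 <;> push_cast <;> ring
  obtain ⟨d1, d2, c2, lim, C, hC⟩ :=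
    deriv_asymptotics_of_eq_comp_exp (hg.comp hsingle) hE
  obtain ⟨-, -, -, lim', D, hD⟩ :=
    deriv_asymptotics_of_eq_comp_exp (u := fun t => u (-t)) (hk.comp hsingle) hH
  have e1 : deriv (fun t => u (-t)) = fun t => -deriv u (-t) := by
    funext t; exact deriv_comp_neg u t
  have e2 : deriv (fun t => -deriv u (-t)) = fun t => deriv (deriv u) (-t) := by
    funext t
    rw [deriv.fun_neg, deriv_comp_neg, neg_neg]
  rw [e1] at lim' hD
  rw [e2] at hD
  refine ⟨u, deriv u, deriv (deriv u), hu, d1, d2, lim, ?_, ⟨max C D, fun t => ?_⟩, ?_⟩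
  · have := (lim'.comp Filter.tendsto_neg_atTop_atBot).neg
    simpa [Function.comp_def] using this
  · rcases le_total t 0 with ht | ht
    · exact (hC t ht).1.trans (le_max_left _ _)
    · have := (hD (-t) (by linarith)).1
      simp only [neg_neg, abs_neg] at this
      exact this.trans (le_max_right _ _)
  · exact integrable_of_exp_bounds c2 (fun t ht => (hC t ht).2) (fun t ht => (hD t ht).2)

/-! ### The central charge in terms of cohomology classes -/

open MeasureTheory in
/-- The integrand is the derivative of `(V + i W)ⁿ / n`. -/
theorem IsMomentumProfile.integral_pow_mul {n : ℕ} (hn : n ≠ 0) {x y x' y' : ℝ}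
    {V V' W W' : ℝ → ℝ} (hV : IsMomentumProfile x y V V') (hW : IsMomentumProfile x' y' W W') :
    ∫ t, ((V t : ℂ) + Complex.I * W t) ^ (n - 1) * (V' t + Complex.I * W' t) =
      (((x : ℂ) + Complex.I * x') ^ n - (((-y : ℝ) : ℂ) + Complex.I * ((-y' : ℝ) : ℂ)) ^ n) / n := by
  have hn' : (n : ℂ) ≠ 0 := by exact_mod_cast hn
  have hd (t : ℝ) : HasDerivAt (fun t => (V t : ℂ) + Complex.I * W t)
      (V' t + Complex.I * W' t) t :=
    (hV.hasDerivAt t).ofReal_comp.add ((hW.hasDerivAt t).ofReal_comp.const_mul _)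
  have hlim {l : Filter ℝ} {v w : ℝ} (h1 : Filter.Tendsto V l (𝓝 v))
      (h2 : Filter.Tendsto W l (𝓝 w)) :
      Filter.Tendsto (fun t => ((V t : ℂ) + Complex.I * W t) ^ n / n) l
        (𝓝 (((v : ℂ) + Complex.I * w) ^ n / n)) := by
    have e1 := (Complex.continuous_ofReal.tendsto v).comp h1
    have e2 := (Complex.continuous_ofReal.tendsto w).comp h2
    exact ((e1.add (e2.const_mul Complex.I)).pow n).div_const _
  obtain ⟨C, hC⟩ := hV.bounded
  obtain ⟨D, hD⟩ := hW.bounded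
  have hcont : Continuous fun t => ((V t : ℂ) + Complex.I * W t) ^ (n - 1) :=
    (continuous_iff_continuousAt.mpr fun t => (hd t).continuousAt).pow _
  have hint : Integrable fun t =>
      ((V t : ℂ) + Complex.I * W t) ^ (n - 1) * (V' t + Complex.I * W' t) := by
    refine Integrable.bdd_mul (c := (C + D) ^ (n - 1)) ?_ hcont.aestronglyMeasurable
      (Filter.Eventually.of_forall fun t => ?_)
    · exact hV.integrable.ofReal.add (hW.integrable.ofReal.const_mul _)
    · rw [norm_pow]
      refine pow_le_pow_left₀ (norm_nonneg _) ((norm_add_le _ _).trans ?_) _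
      have h1 := hC t
      have h2 := hD t
      simp only [norm_mul, Complex.norm_I, one_mul, Complex.norm_real, Real.norm_eq_abs]
      linarith
  rw [integral_of_hasDerivAt_of_tendsto (fun t => ?_) hint
    (hlim hV.tendsto_atBot hW.tendsto_atBot) (hlim hV.tendsto_atTop hW.tendsto_atTop), sub_div]
  have := ((hd t).pow n).div_const (n : ℂ)
  rwa [mul_assoc, mul_div_cancel_left₀ _ hn'] at this

open BlowUp in
/-- The top self-intersection numbers of `Bl_p ℙⁿ`: `(x H + y E)ⁿ = xⁿ - (-y)ⁿ` (as `Hⁿ = 1`,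
`Eⁿ = (-1)ⁿ⁻¹` and `H · E = 0`), for the complex class with real part `x H + y E` and imaginary
part `x' H + y' E`. -/
theorem integralTopPower_eq {n : ℕ} (hn : n ≠ 0) {x y x' y' : ℝ} {φ ψ : BlowUp n → ℝ}
    (hφ : IsCalabiWeight n x y φ) (hψ : IsCalabiWeight n x' y' ψ) :
    integralTopPower (fun z => chernMatrix φ z + Complex.I • chernMatrix ψ z) =
      ((x : ℂ) + Complex.I * x') ^ n - (((-y : ℝ) : ℂ) + Complex.I * ((-y' : ℝ) : ℂ)) ^ n := by
  obtain ⟨u, V, V', hu, huV, hV⟩ := hφ.exists_momentumProfile hn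
  obtain ⟨u₁, W, W', hu₁, huW, hW⟩ := hψ.exists_momentumProfile hn
  have : Nonempty (Fin n) := ⟨⟨0, Nat.pos_of_ne_zero hn⟩⟩
  have hae : ∀ᵐ z : Fin n → ℂ, z ≠ 0 :=
    MeasureTheory.compl_mem_ae_iff.mpr (MeasureTheory.measure_singleton 0)
  have hdet : ∫ z : Fin n → ℂ, (chernMatrix φ z + Complex.I • chernMatrix ψ z).det =
      ∫ z : Fin n → ℂ, (fun t => ((V t : ℂ) + Complex.I * W t) ^ (n - 1) *
        (V' t + Complex.I * W' t)) (Real.log (radiusSq z)) / (radiusSq z : ℂ) ^ n := by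
    refine MeasureTheory.integral_congr_ae ?_
    filter_upwards [hae] with z hz
    exact det_chernMatrix_add hn hu huV hV.hasDerivAt hu₁ huW hW.hasDerivAt hz
  rw [integralTopPower, hdet, integral_comp_log_radiusSq hn fun t =>
    ((V t : ℂ) + Complex.I * W t) ^ (n - 1) * (V' t + Complex.I * W' t), hV.integral_pow_mul hn hW]
  obtain ⟨m, rfl⟩ := Nat.exists_eq_succ_of_ne_zero hn
  have h1 : ((m.factorial : ℕ) : ℂ) ≠ 0 := by exact_mod_cast m.factorial_ne_zero
  have h2 : ((m : ℂ) + 1) ≠ 0 := by exact_mod_cast m.succ_ne_zero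
  have h3 : (Real.pi : ℂ) ≠ 0 := by exact_mod_cast Real.pi_ne_zero
  simp only [Nat.succ_eq_add_one, Nat.add_sub_cancel, Nat.factorial_succ]
  push_cast
  field_simp

/-! ### The phase angle -/

theorem cos_nat_mul_lt_cos_pow {n : ℕ} (hn : 2 ≤ n) {β : ℝ} (hβ : 0 < β) (hnβ : n * β ≤ Real.pi) :
    Real.cos (n * β) < Real.cos β ^ n := by
  induction n, hn using Nat.le_induction with
  | base =>
    push_cast at hnβ ⊢
    have := Real.sin_pos_of_pos_of_lt_pi hβ (by linarith)
    have := Real.sin_sq_add_cos_sq β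
    rw [Real.cos_two_mul]
    nlinarith
  | succ n hn ih =>
    push_cast at hnβ ⊢
    have hn' : (2 : ℝ) ≤ n := by exact_mod_cast hn
    have hpos : 0 < n * β := by positivity
    have h1 := ih (by linarith)
    have h2 := Real.sin_pos_of_pos_of_lt_pi hpos (by linarith)
    have h3 := Real.sin_pos_of_pos_of_lt_pi hβ (by nlinarith)
    have h4 : 0 ≤ Real.cos β := Real.cos_nonneg_of_neg_pi_div_two_le_of_le (by linarith)
      (by nlinarith)
    rw [add_mul, one_mul, Real.cos_add, pow_succ]
    nlinarith [mul_pos h2 h3, mul_le_mul_of_nonneg_right h1.le h4]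

theorem one_add_I_mul_tan_pow {α : ℝ} (hα : Real.cos α ≠ 0) (n : ℕ) :
    (1 + Complex.I * (Real.tan α : ℝ)) ^ n =
      (Real.cos (n * α) + Complex.I * Real.sin (n * α) : ℂ) / (Real.cos α : ℂ) ^ n := by
  have h : (Real.cos α : ℂ) ≠ 0 := by exact_mod_cast hα
  rw [eq_div_iff (pow_ne_zero _ h), ← mul_pow]
  have e : (1 + Complex.I * (Real.tan α : ℝ)) * (Real.cos α : ℂ) =
      Complex.cos α + Complex.sin α * Complex.I := by
    rw [Real.tan_eq_sin_div_cos]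
    push_cast at h ⊢
    field_simp
  rw [e, Complex.cos_add_sin_mul_I_pow]
  push_cast
  ring

theorem re_im_one_sub_pow {β : ℝ} (hβ : Real.cos β ≠ 0) (n : ℕ) :
    (1 - (1 + Complex.I * ((-Real.tan β : ℝ) : ℂ)) ^ n).re =
        1 - Real.cos (n * β) / Real.cos β ^ n ∧
      (1 - (1 + Complex.I * ((-Real.tan β : ℝ) : ℂ)) ^ n).im =
        Real.sin (n * β) / Real.cos β ^ n := by
  have h := one_add_I_mul_tan_pow (α := -β) (by rwa [Real.cos_neg]) n
  rw [Real.tan_neg, mul_neg, Real.cos_neg, Real.sin_neg, Real.cos_neg] at h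
  have e : ((Real.cos (n * β) : ℂ) + Complex.I * ((-Real.sin (n * β) : ℝ) : ℂ)) /
      (Real.cos β : ℂ) ^ n =
      ((Real.cos (n * β) / Real.cos β ^ n : ℝ) : ℂ) +
        Complex.I * ((-(Real.sin (n * β) / Real.cos β ^ n) : ℝ) : ℂ) := by
    push_cast
    ring
  rw [h, e]
  constructor
  · simp [-Complex.ofReal_div, -Complex.ofReal_neg, -Complex.ofReal_pow]
  · simp [-Complex.ofReal_div, -Complex.ofReal_neg, -Complex.ofReal_pow]

/-- For negative `p`, the number `1 - (1 + i p)ⁿ` lies in the open first quadrant, and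
`phaseAngle n p` is its argument. -/
theorem phaseAngle_spec {n : ℕ} (hn : 2 ≤ n) {β : ℝ} (hβ : 0 < β) (hβ' : β < Real.pi / 2)
    (hnβ : n * β < Real.pi) :
    0 < phaseAngle n (-Real.tan β) ∧ phaseAngle n (-Real.tan β) < Real.pi / 2 ∧
    ∃ c : ℝ, 0 < c ∧
      c * Real.cos (phaseAngle n (-Real.tan β)) = 1 - Real.cos (n * β) / Real.cos β ^ n ∧
      c * Real.sin (phaseAngle n (-Real.tan β)) = Real.sin (n * β) / Real.cos β ^ n := by
  have hc : 0 < Real.cos β := Real.cos_pos_of_mem_Ioo ⟨by linarith, hβ'⟩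
  have hcn : 0 < Real.cos β ^ n := pow_pos hc n
  obtain ⟨e1, e2⟩ := re_im_one_sub_pow hc.ne' n
  have htan : 0 < Real.tan β := Real.tan_pos_of_pos_of_lt_pi_div_two hβ hβ'
  have hn0 : (0 : ℝ) < n := by exact_mod_cast (by omega : 0 < n)
  rw [phaseAngle, e1, e2, if_neg (by linarith), add_zero]
  set R := 1 - Real.cos (n * β) / Real.cos β ^ n
  set S := Real.sin (n * β) / Real.cos β ^ n
  have hR : 0 < R := by
    have := (div_lt_one hcn).mpr (cos_nat_mul_lt_cos_pow hn hβ hnβ.le)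
    simp only [R]; linarith
  have hS : 0 < S := div_pos (Real.sin_pos_of_pos_of_lt_pi (by positivity) hnβ) hcn
  have hcos := Real.cos_arctan_pos (S / R)
  refine ⟨Real.arctan_pos.mpr (by positivity), Real.arctan_lt_pi_div_two _,
    R / Real.cos (Real.arctan (S / R)), by positivity, by field_simp, ?_⟩
  have := Real.tan_arctan (S / R)
  rw [Real.tan_eq_sin_div_cos] at this
  rw [div_mul_eq_mul_div, mul_div_assoc, this]
  field_simp

/-- The key estimate: the angle between the imaginary axis and `1 - (1 + i p)ⁿ` is less than
`(n - 1) |arctan p|`. -/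
theorem pi_div_two_sub_lt {n : ℕ} (hn : 2 ≤ n) {β θ c : ℝ} (hβ : 0 < β) (hβ' : β < Real.pi / 2)
    (hθ : 0 < θ) (hc : 0 < c)
    (h1 : c * Real.cos θ = 1 - Real.cos (n * β) / Real.cos β ^ n)
    (h2 : c * Real.sin θ = Real.sin (n * β) / Real.cos β ^ n) :
    Real.pi / 2 - θ < (n - 1) * β := by
  have hcos : 0 < Real.cos β := Real.cos_pos_of_mem_Ioo ⟨by linarith, hβ'⟩
  have hcn : 0 < Real.cos β ^ n := pow_pos hcos n
  have hcos1 : Real.cos β < 1 := by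
    have := Real.cos_lt_cos_of_nonneg_of_le_pi le_rfl (by linarith [Real.pi_pos]) hβ
    rwa [Real.cos_zero] at this
  have hn' : (2 : ℝ) ≤ n := by exact_mod_cast hn
  by_contra! hle
  have hsin : Real.sin ((n - 1) * β - (Real.pi / 2 - θ)) ≤ 0 :=
    Real.sin_nonpos_of_nonpos_of_neg_pi_le (by linarith) (by nlinarith [Real.pi_pos])
  have e : c * Real.sin ((n - 1) * β - (Real.pi / 2 - θ)) =
      (Real.cos β - Real.cos β ^ n * Real.cos ((n - 1) * β)) / Real.cos β ^ n := by
    have e0 : Real.cos β = Real.cos (n * β - (n - 1) * β) := by congr 1; ring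
    have e1 : c * Real.sin ((n - 1) * β - (Real.pi / 2 - θ)) =
        Real.sin ((n - 1) * β) * (c * Real.sin θ) - Real.cos ((n - 1) * β) * (c * Real.cos θ) := by
      rw [Real.sin_sub, Real.cos_pi_div_two_sub, Real.sin_pi_div_two_sub]; ring
    rw [e1, h1, h2, sub_div, mul_div_cancel_left₀ _ hcn.ne']
    have e2 : Real.cos β / Real.cos β ^ n =
        (Real.cos (n * β) * Real.cos ((n - 1) * β) + Real.sin (n * β) * Real.sin ((n - 1) * β)) /
          Real.cos β ^ n := by
      rw [← Real.cos_sub, ← e0]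
    rw [e2]
    ring
  have h3 : Real.cos β ^ n < Real.cos β := by
    simpa using pow_lt_pow_right_of_lt_one₀ hcos hcos1 (show 1 < n by omega)
  have h4 : Real.cos β ^ n * Real.cos ((n - 1) * β) ≤ Real.cos β ^ n :=
    mul_le_of_le_one_right hcn.le (Real.cos_le_one _)
  have h5 : 0 < (Real.cos β - Real.cos β ^ n * Real.cos ((n - 1) * β)) / Real.cos β ^ n :=
    div_pos (by linarith) hcn
  rw [← e] at h5
  nlinarith [mul_nonneg hc.le (neg_nonneg.mpr hsin)]

theorem phaseAngle_neg {n : ℕ} {p : ℝ} (hp : p < 0) :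
    phaseAngle n (-p) = Real.pi - phaseAngle n p := by
  have h : 1 - (1 + Complex.I * ((-p : ℝ) : ℂ)) ^ n =
      (starRingEnd ℂ) (1 - (1 + Complex.I * (p : ℂ)) ^ n) := by
    simp [map_sub, map_pow]
  rw [phaseAngle, phaseAngle, h, Complex.conj_re, Complex.conj_im, neg_div, Real.arctan_neg,
    if_pos (by linarith), if_neg (by linarith)]
  ring

theorem critPoint_neg {n : ℕ} {p : ℝ} (hp : p < 0) : critPoint n (-p) = -critPoint n p := by
  rw [critPoint, critPoint, phaseAngle_neg hp, ← Real.tan_neg]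
  congr 1; ring

theorem kahlerParam_neg {n : ℕ} {p : ℝ} (hp : p < 0) : kahlerParam n (-p) = kahlerParam n p := by
  rw [kahlerParam, kahlerParam, phaseAngle_neg hp, Real.sin_pi_sub,
    ← Real.cos_neg ((phaseAngle n p - Real.pi / 2) / ((n : ℝ) - 1))]
  congr 4; ring

/-! ### Positions of the central charges in the plane near `b = 1` -/

/-- With `α = (θ - π / 2) / (n - 1)` and `A = aⁿ`, the complex conjugate of `Z(L₂)` at `b = 1` is
a real multiple of `exp (i θ)`. -/
theorem sub_one_add_I_mul_tan_pow {n : ℕ} {θ α A : ℝ} (hα : 0 < Real.cos α)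
    (hnα : n * α = θ + α - Real.pi / 2) (hA : A * Real.sin θ * Real.cos α ^ n = Real.cos α) :
    (A : ℂ) - (1 + Complex.I * (Real.tan α : ℝ)) ^ n =
      ((A * Real.cos (θ + α) / Real.cos α : ℝ) : ℂ) * (Real.cos θ + Complex.I * Real.sin θ) := by
  have hcn : 0 < Real.cos α ^ n := pow_pos hα n
  rw [one_add_I_mul_tan_pow hα.ne', hnα, Real.cos_sub_pi_div_two, Real.sin_sub_pi_div_two]
  have e : ((Real.sin (θ + α) : ℂ) + Complex.I * ((-Real.cos (θ + α) : ℝ) : ℂ)) /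
      (Real.cos α : ℂ) ^ n =
      ((Real.sin (θ + α) / Real.cos α ^ n : ℝ) : ℂ) +
        Complex.I * ((-(Real.cos (θ + α) / Real.cos α ^ n) : ℝ) : ℂ) := by
    push_cast
    ring
  have hinv : ∀ x : ℝ, x / Real.cos α ^ n = A * Real.sin θ * x / Real.cos α := fun x => by
    rw [div_eq_div_iff hcn.ne' hα.ne']; linear_combination (-x) * hA
  have hcs : Real.cos α = Real.cos (θ + α) * Real.cos θ + Real.sin (θ + α) * Real.sin θ := by
    rw [← Real.cos_sub]; congr 1; ring
  rw [e, hinv, hinv]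
  apply Complex.ext
  · have key : A - A * Real.sin θ * Real.sin (θ + α) / Real.cos α =
        A * Real.cos (θ + α) / Real.cos α * Real.cos θ := by
      field_simp
      linear_combination A * hcs
    simpa only [Complex.sub_re, Complex.add_re, Complex.ofReal_re, Complex.I_mul_re,
      Complex.ofReal_im, Complex.re_ofReal_mul, neg_zero, add_zero] using key
  · simp only [Complex.sub_im, Complex.add_im, Complex.ofReal_re, Complex.I_mul_im,
      Complex.ofReal_im, Complex.im_ofReal_mul]
    ring

/-- The complex conjugate of `Z(L₁)` as a function of `b`. -/
noncomputable def conjChargeOne (n : ℕ) (p b : ℝ) : ℂ :=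
  ((kahlerParam n p : ℂ) + Complex.I * ((kahlerParam n p * p : ℝ) : ℂ)) ^ n -
    ((b : ℂ) + Complex.I * (critPoint n p : ℂ)) ^ n

/-- The complex conjugate of `Z(L₂)` as a function of `b`. -/
noncomputable def conjChargeTwo (n : ℕ) (p b : ℝ) : ℂ :=
  (kahlerParam n p : ℂ) ^ n - ((b : ℂ) + Complex.I * (critPoint n p : ℂ)) ^ n

theorem arctan_neg_bounds {n : ℕ} (hn : 2 ≤ n) {p : ℝ}
    (hp : n = 2 ∨ -Real.tan (Real.pi / n) < p) (hp0 : p < 0) :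
    0 < Real.arctan (-p) ∧ Real.arctan (-p) < Real.pi / 2 ∧ n * Real.arctan (-p) < Real.pi := by
  have h2 := Real.arctan_lt_pi_div_two (-p)
  refine ⟨Real.arctan_pos.mpr (by linarith), h2, ?_⟩
  rcases eq_or_ne n 2 with rfl | hne
  · push_cast; linarith
  · have hn3 : (3 : ℝ) ≤ n := by exact_mod_cast (by omega : 3 ≤ n)
    have hlt := hp.resolve_left hne
    have hpi := Real.pi_pos
    have h1 : Real.pi / n < Real.pi / 2 := by
      apply div_lt_div_of_pos_left hpi (by norm_num) (by linarith)
    have h3 : Real.arctan (-p) < Real.pi / n := by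
      have := Real.arctan_strictMono (show -p < Real.tan (Real.pi / n) by linarith)
      rwa [Real.arctan_tan (by have : 0 < Real.pi / n := by positivity
                               linarith) h1] at this
    rwa [lt_div_iff₀ (by linarith), mul_comm] at h3

theorem lt_one_iff_of_deriv_pos {D : ℝ → ℝ} {d : ℝ} (hD : HasDerivAt D d 1) (hd : 0 < d)
    (h0 : D 1 = 0) : ∀ᶠ b in 𝓝 (1 : ℝ), (b < 1 ↔ D b < 0) := by
  filter_upwards [eventually_nhdsWithin_sign_eq_of_deriv_pos (by rwa [hD.deriv]) h0] with b hb
  rw [← sign_eq_neg_one_iff, hb, sign_eq_neg_one_iff, sub_neg]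

/-- Write `1 - (1 + i p)ⁿ = c exp (i θ)`. At `b = 1` the two charges are real multiples of
`exp (i θ)` of opposite signs, by `sub_one_add_I_mul_tan_pow` and `pi_div_two_sub_lt`. Their difference `aⁿ c exp (i θ)`
does not depend on `b`, so that their relative position is that of `conjChargeTwo` with respect to
the line spanned by `exp (i θ)`, which it crosses at `b = 1` with positive speed. -/
theorem eventually_position_conjCharge {n : ℕ} (hn : 2 ≤ n) {p : ℝ}
    (hp : n = 2 ∨ -Real.tan (Real.pi / n) < p) (hp0 : p < 0) :
    ∀ᶠ b in 𝓝 (1 : ℝ),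
      0 < (conjChargeTwo n p b).re ∧ 0 < (conjChargeTwo n p b).im ∧
      (conjChargeOne n p b).re < 0 ∧ (conjChargeOne n p b).im < 0 ∧
      (b < 1 ↔ (conjChargeOne n p b).im * (conjChargeTwo n p b).re <
        (conjChargeOne n p b).re * (conjChargeTwo n p b).im) := by
  have hn' : (2 : ℝ) ≤ n := by exact_mod_cast hn
  have hpi := Real.pi_pos
  obtain ⟨hβ, hβ', hnβ⟩ := arctan_neg_bounds hn hp hp0
  have hpβ : -Real.tan (Real.arctan (-p)) = p := by rw [Real.tan_arctan, neg_neg]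
  obtain ⟨hθ, hθ', c, hc, hre, him⟩ := phaseAngle_spec hn hβ hβ' hnβ
  obtain ⟨hre', him'⟩ := re_im_one_sub_pow (β := Real.arctan (-p))
    (Real.cos_pos_of_mem_Ioo ⟨by linarith, hβ'⟩).ne' n
  rw [hpβ] at hθ hθ' hre him hre' him'
  generalize hβdef : Real.arctan (-p) = β at *
  have hangle := pi_div_two_sub_lt hn hβ hβ' hθ hc hre him
  set θ := phaseAngle n p with hθdef
  obtain ⟨α, hα⟩ : ∃ α, α = (θ - Real.pi / 2) / ((n : ℝ) - 1) := ⟨_, rfl⟩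
  have hα1 : (n - 1) * α = θ - Real.pi / 2 := by
    rw [hα, mul_div_cancel₀]; linarith
  have hα0 : α < 0 := by nlinarith
  have hαβ : -β < α := by nlinarith
  have hcosα : 0 < Real.cos α := Real.cos_pos_of_mem_Ioo ⟨by linarith, by linarith⟩
  have hcosβ : 0 < Real.cos β := Real.cos_pos_of_mem_Ioo ⟨by linarith, hβ'⟩
  have hsinθ : 0 < Real.sin θ := Real.sin_pos_of_pos_of_lt_pi hθ (by linarith)
  have hcosθ : 0 < Real.cos θ := Real.cos_pos_of_mem_Ioo ⟨by linarith, hθ'⟩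
  have hq : critPoint n p = Real.tan α := by rw [critPoint, ← hθdef, ← hα]
  have hX : 0 < Real.sin θ * Real.cos α ^ (n - 1) := mul_pos hsinθ (pow_pos hcosα _)
  have ha : kahlerParam n p ^ n = (Real.sin θ * Real.cos α ^ (n - 1))⁻¹ := by
    rw [kahlerParam, ← hθdef, ← hα, ← Real.rpow_natCast, ← Real.rpow_mul hX.le, neg_mul,
      one_div_mul_cancel (by linarith), Real.rpow_neg_one]
  obtain ⟨A, hA⟩ : ∃ A, A = kahlerParam n p ^ n := ⟨_, rfl⟩
  have hApos : 0 < A := by rw [hA, ha]; positivity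
  have hAX : A * Real.sin θ * Real.cos α ^ n = Real.cos α := by
    have : Real.cos α ^ n = Real.cos α ^ (n - 1) * Real.cos α := by
      rw [← pow_succ]; congr 1; omega
    rw [this, hA, ha]
    field_simp
  have hE : (1 + Complex.I * (p : ℂ)) ^ n =
      1 - ((c * Real.cos θ : ℝ) : ℂ) - Complex.I * ((c * Real.sin θ : ℝ) : ℂ) := by
    rw [hre, him, ← hre', ← him']
    linear_combination Complex.re_add_im (1 - (1 + Complex.I * (p : ℂ)) ^ n)
  -- The difference of the two charges does not depend on `b`.
  have hdiff (b : ℝ) : conjChargeOne n p b = conjChargeTwo n p b -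
      (((A * c * Real.cos θ : ℝ) : ℂ) + Complex.I * ((A * c * Real.sin θ : ℝ) : ℂ)) := by
    have e : ((kahlerParam n p : ℂ) + Complex.I * ((kahlerParam n p * p : ℝ) : ℂ)) ^ n =
        (A : ℂ) * (1 + Complex.I * (p : ℂ)) ^ n := by
      rw [hA, Complex.ofReal_pow, ← mul_pow]
      push_cast
      ring
    rw [conjChargeOne, conjChargeTwo, e, hE, ← Complex.ofReal_pow, ← hA]
    push_cast
    ring
  have hdre (b : ℝ) :
      (conjChargeOne n p b).re = (conjChargeTwo n p b).re - A * c * Real.cos θ := by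
    rw [hdiff]; simp [-Complex.ofReal_mul]
  have hdim (b : ℝ) :
      (conjChargeOne n p b).im = (conjChargeTwo n p b).im - A * c * Real.sin θ := by
    rw [hdiff]; simp [-Complex.ofReal_mul]
  -- Both charges at `b = 1`.
  have htwo : conjChargeTwo n p 1 =
      ((A * Real.cos (θ + α) / Real.cos α : ℝ) : ℂ) * (Real.cos θ + Complex.I * Real.sin θ) := by
    rw [← sub_one_add_I_mul_tan_pow hcosα (by linarith) hAX, conjChargeTwo, hq,
      ← Complex.ofReal_pow, ← hA, Complex.ofReal_one]
  obtain ⟨κ, hκ⟩ : ∃ κ, κ = A * Real.cos (θ + α) / Real.cos α := ⟨_, rfl⟩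
  rw [← hκ] at htwo
  have htwore : (conjChargeTwo n p 1).re = κ * Real.cos θ := by
    rw [htwo, Complex.re_ofReal_mul, Complex.add_re, Complex.ofReal_re, Complex.I_mul_re,
      Complex.ofReal_im, neg_zero, add_zero]
  have htwoim : (conjChargeTwo n p 1).im = κ * Real.sin θ := by
    rw [htwo, Complex.im_ofReal_mul, Complex.add_im, Complex.ofReal_im, Complex.I_mul_im,
      Complex.ofReal_re, zero_add]
  have hκpos : 0 < κ := by
    have : 0 < Real.cos (θ + α) := Real.cos_pos_of_mem_Ioo ⟨by linarith, by linarith⟩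
    rw [hκ]; positivity
  have hκlt : κ < A * c := by
    rw [hκ, div_lt_iff₀ hcosα, mul_assoc]
    refine mul_lt_mul_of_pos_left ?_ hApos
    have hcn : 0 < Real.cos β ^ n := pow_pos hcosβ n
    have h1 : Real.cos (n * β) = (1 - c * Real.cos θ) * Real.cos β ^ n := by
      rw [hre]; field_simp; ring
    have h2 : Real.sin (n * β) = c * Real.sin θ * Real.cos β ^ n := by
      rw [him]; field_simp
    -- The angle is `π / 2 + n (β + α)`, where `0 < β + α < π / n`.
    have h3 : Real.cos (n * β + (θ + α)) < 0 :=
      Real.cos_neg_of_pi_div_two_lt_of_lt (by nlinarith) (by nlinarith)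
    have h4 : Real.cos (n * β + (θ + α)) =
        (Real.cos (θ + α) - c * Real.cos α) * Real.cos β ^ n := by
      have h5 : Real.cos α = Real.cos (θ + α) * Real.cos θ + Real.sin (θ + α) * Real.sin θ := by
        rw [← Real.cos_sub]; congr 1; ring
      rw [Real.cos_add, h1, h2, h5]
      ring
    rw [h4] at h3
    have := neg_of_mul_neg_left h3 hcn.le
    linarith
  -- The crossing of the line spanned by `exp (i θ)`.
  have hderiv : HasDerivAt (conjChargeTwo n p)
      (((-(n / Real.cos α ^ (n - 1) * Real.sin θ) : ℝ) : ℂ) +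
        Complex.I * ((n / Real.cos α ^ (n - 1) * Real.cos θ : ℝ) : ℂ)) 1 := by
    have h := ((((hasDerivAt_id (1 : ℝ)).ofReal_comp.add_const
      (Complex.I * (critPoint n p : ℂ))).pow n).const_sub ((kahlerParam n p : ℂ) ^ n))
    refine h.congr_deriv ?_
    have h' := one_add_I_mul_tan_pow hcosα.ne' (n - 1)
    have hcast : (((n - 1 : ℕ) : ℝ)) = n - 1 := by
      rw [Nat.cast_sub (by omega)]; simp
    rw [hcast, hα1, Real.cos_sub_pi_div_two, Real.sin_sub_pi_div_two] at h'
    simp only [id, hq, Complex.ofReal_one, h']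
    push_cast
    ring
  have hD : HasDerivAt
      (fun b => Real.cos θ * (conjChargeTwo n p b).im - Real.sin θ * (conjChargeTwo n p b).re)
      (n / Real.cos α ^ (n - 1)) 1 := by
    have h1 := (Complex.imCLM.hasFDerivAt.comp_hasDerivAt (1 : ℝ) hderiv).const_mul (Real.cos θ)
    have h2 := (Complex.reCLM.hasFDerivAt.comp_hasDerivAt (1 : ℝ) hderiv).const_mul (Real.sin θ)
    refine (h1.sub h2).congr_deriv ?_
    simp only [Complex.imCLM_apply, Complex.reCLM_apply, Complex.add_im, Complex.add_re,
      Complex.ofReal_im, Complex.ofReal_re, Complex.I_mul_im, Complex.I_mul_re]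
    linear_combination (n / Real.cos α ^ (n - 1)) * Real.sin_sq_add_cos_sq θ
  have hsign := lt_one_iff_of_deriv_pos hD (by positivity) (by rw [htwore, htwoim]; ring)
  have hcre : ContinuousAt (fun b => (conjChargeTwo n p b).re) 1 :=
    Complex.continuous_re.continuousAt.comp hderiv.continuousAt
  have hcim : ContinuousAt (fun b => (conjChargeTwo n p b).im) 1 :=
    Complex.continuous_im.continuousAt.comp hderiv.continuousAt
  have e1 : 0 < (conjChargeTwo n p 1).re := by rw [htwore]; positivity
  have e2 : 0 < (conjChargeTwo n p 1).im := by rw [htwoim]; positivity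
  have e3 : (conjChargeTwo n p 1).re < A * c * Real.cos θ := by
    rw [htwore]; exact mul_lt_mul_of_pos_right hκlt hcosθ
  have e4 : (conjChargeTwo n p 1).im < A * c * Real.sin θ := by
    rw [htwoim]; exact mul_lt_mul_of_pos_right hκlt hsinθ
  filter_upwards [hsign, hcre.eventually (eventually_gt_nhds e1),
    hcim.eventually (eventually_gt_nhds e2), hcre.eventually (eventually_lt_nhds e3),
    hcim.eventually (eventually_lt_nhds e4)] with b hb h1 h2 h3 h4
  refine ⟨h1, h2, by rw [hdre]; linarith, by rw [hdim]; linarith, ?_⟩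
  rw [hb, hdre, hdim, ← sub_neg (a := _ * _)]
  have hAc : 0 < A * c := mul_pos hApos hc
  have e : ((conjChargeTwo n p b).im - A * c * Real.sin θ) * (conjChargeTwo n p b).re -
      ((conjChargeTwo n p b).re - A * c * Real.cos θ) * (conjChargeTwo n p b).im =
      A * c * (Real.cos θ * (conjChargeTwo n p b).im -
        Real.sin θ * (conjChargeTwo n p b).re) := by ring
  rw [e]
  constructor
  · exact fun h => mul_neg_of_pos_of_neg hAc h
  · exact fun h => neg_of_mul_neg_right h hAc.le

/-! ### Slopes and arguments -/

theorem arg_lt_arg_iff_of_im_pos {z w : ℂ} (hz : 0 < z.im) (hw : 0 < w.im) :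
    z.arg < w.arg ↔ z.im * w.re < z.re * w.im := by
  have hz0 : 0 < ‖z‖ := norm_pos_iff.mpr fun h => by simp [h] at hz
  have hw0 : 0 < ‖w‖ := norm_pos_iff.mpr fun h => by simp [h] at hw
  have bounds {v : ℂ} (hv : 0 < v.im) : 0 < v.arg ∧ v.arg < Real.pi := by
    refine ⟨lt_of_le_of_ne (Complex.arg_nonneg_iff.mpr hv.le) fun h => ?_,
      Complex.arg_lt_pi_iff.mpr (Or.inr hv.ne')⟩
    exact hv.ne' (Complex.arg_eq_zero_iff.mp h.symm).2
  obtain ⟨hz1, hz2⟩ := bounds hz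
  obtain ⟨hw1, hw2⟩ := bounds hw
  have e : z.re * w.im - z.im * w.re = ‖z‖ * ‖w‖ * Real.sin (w.arg - z.arg) := by
    rw [Real.sin_sub, ← Complex.norm_mul_cos_arg z, ← Complex.norm_mul_sin_arg z,
      ← Complex.norm_mul_cos_arg w, ← Complex.norm_mul_sin_arg w]
    ring
  rw [← sub_pos (b := z.im * w.re), e]
  have hpos : 0 < ‖z‖ * ‖w‖ := mul_pos hz0 hw0
  constructor
  · exact fun h => mul_pos hpos (Real.sin_pos_of_pos_of_lt_pi (by linarith) (by linarith))
  · intro h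
    by_contra! hle
    have := Real.sin_nonpos_of_nonpos_of_neg_pi_le (x := w.arg - z.arg) (by linarith) (by linarith)
    nlinarith

theorem zSlope_lt_zSlope_iff_of_neg_of_pos {z w : ℂ} (hz : z.re < 0) (hw : 0 < w.re) :
    zSlope z < zSlope w ↔ z.re * w.im < z.im * w.re := by
  rw [zSlope, zSlope, ← neg_div_neg_eq, div_lt_div_iff₀ (by linarith) hw]
  constructor <;> intro h <;> linarith

theorem zSlope_lt_zSlope_iff_of_pos_of_neg {z w : ℂ} (hz : 0 < z.re) (hw : w.re < 0) :
    zSlope z < zSlope w ↔ z.re * w.im < z.im * w.re := by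
  rw [zSlope, zSlope, ← neg_div_neg_eq w.im, div_lt_div_iff₀ hz (by linarith)]
  constructor <;> intro h <;> linarith

theorem centralCharge_eq {n : ℕ} (hn : n ≠ 0) {a b : ℝ} {L : ShiftedRLineBundle}
    {φ ψ : BlowUp n → ℝ} (hφ : IsCalabiWeight n a (-b) φ)
    (hψ : IsCalabiWeight n L.coeffH L.coeffE ψ) :
    centralCharge φ L ψ = (-1) ^ L.deg * (((a : ℂ) + Complex.I * L.coeffH) ^ n -
      ((b : ℂ) + Complex.I * ((-L.coeffE : ℝ) : ℂ)) ^ n) := by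
  rw [centralCharge, integralTopPower_eq hn hφ hψ, neg_neg]

theorem centralCharge_shift {n : ℕ} (φ : BlowUp n → ℝ) (L : ShiftedRLineBundle)
    (ψ : BlowUp n → ℝ) : centralCharge φ L.shift ψ = -centralCharge φ L ψ := by
  rw [centralCharge, centralCharge, ShiftedRLineBundle.shift,
    zpow_add_one₀ (by norm_num : (-1 : ℂ) ≠ 0)]
  ring

theorem centralCharge_lineBundleOne {n : ℕ} (hn : n ≠ 0) {p b : ℝ} {φ ψ : BlowUp n → ℝ}
    (hφ : IsCalabiWeight n (kahlerParam n p) (-b) φ)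
    (hψ : IsCalabiWeight n (lineBundleOne n p).coeffH (lineBundleOne n p).coeffE ψ) :
    centralCharge φ (lineBundleOne n p) ψ = (starRingEnd ℂ) (conjChargeOne n p b) := by
  rw [centralCharge_eq hn hφ hψ]
  simp [lineBundleOne, conjChargeOne]

theorem centralCharge_lineBundleTwo {n : ℕ} (hn : n ≠ 0) {p b : ℝ} {φ ψ : BlowUp n → ℝ}
    (hφ : IsCalabiWeight n (kahlerParam n p) (-b) φ)
    (hψ : IsCalabiWeight n (lineBundleTwo n p).coeffH (lineBundleTwo n p).coeffE ψ) :
    centralCharge φ (lineBundleTwo n p) ψ = (starRingEnd ℂ) (conjChargeTwo n p b) := by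
  rw [centralCharge_eq hn hφ hψ]
  simp [lineBundleTwo, conjChargeTwo]

theorem conjChargeOne_neg {n : ℕ} {p : ℝ} (hp : p < 0) (b : ℝ) :
    conjChargeOne n (-p) b = (starRingEnd ℂ) (conjChargeOne n p b) := by
  simp [conjChargeOne, kahlerParam_neg hp, critPoint_neg hp]

theorem conjChargeTwo_neg {n : ℕ} {p : ℝ} (hp : p < 0) (b : ℝ) :
    conjChargeTwo n (-p) b = (starRingEnd ℂ) (conjChargeTwo n p b) := by
  simp [conjChargeTwo, kahlerParam_neg hp, critPoint_neg hp]

/-! ### The comparison of slopes and phases -/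

/-- In the hypotheses on `p`, the case `n = 2` is separate because `tan (π / 2) = ∞`. -/
theorem proposition5p2 (n : ℕ) (hn : 2 ≤ n) (p : ℝ) :
    ((n = 2 ∨ -Real.tan (Real.pi / n) < p) → p < 0 →
      ∀ᶠ b in 𝓝 (1 : ℝ),
        ∀ φ : BlowUp n → ℝ, IsCalabiWeight n (kahlerParam n p) (-b) φ →
        ∀ ψ₁ : BlowUp n → ℝ,
          IsCalabiWeight n (lineBundleOne n p).coeffH (lineBundleOne n p).coeffE ψ₁ →
        ∀ ψ₂ : BlowUp n → ℝ,
          IsCalabiWeight n (lineBundleTwo n p).coeffH (lineBundleTwo n p).coeffE ψ₂ →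
          (centralCharge φ (lineBundleOne n p) ψ₁).re ≠ 0 ∧
          (centralCharge φ (lineBundleTwo n p) ψ₂).re ≠ 0 ∧
          (b < 1 ↔ zSlope (centralCharge φ (lineBundleOne n p) ψ₁) <
            zSlope (centralCharge φ (lineBundleTwo n p) ψ₂)) ∧
          0 < (centralCharge φ (lineBundleOne n p) ψ₁).im ∧
          0 < (centralCharge φ (lineBundleTwo n p).shift ψ₂).im ∧
          (b < 1 ↔ (centralCharge φ (lineBundleOne n p) ψ₁).arg <
            (centralCharge φ (lineBundleTwo n p).shift ψ₂).arg)) ∧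
    (0 < p → (n = 2 ∨ p < Real.tan (Real.pi / n)) →
      ∀ᶠ b in 𝓝 (1 : ℝ),
        ∀ φ : BlowUp n → ℝ, IsCalabiWeight n (kahlerParam n p) (-b) φ →
        ∀ ψ₁ : BlowUp n → ℝ,
          IsCalabiWeight n (lineBundleOne n p).coeffH (lineBundleOne n p).coeffE ψ₁ →
        ∀ ψ₂ : BlowUp n → ℝ,
          IsCalabiWeight n (lineBundleTwo n p).coeffH (lineBundleTwo n p).coeffE ψ₂ →
          (centralCharge φ (lineBundleOne n p) ψ₁).re ≠ 0 ∧
          (centralCharge φ (lineBundleTwo n p) ψ₂).re ≠ 0 ∧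
          (b < 1 ↔ zSlope (centralCharge φ (lineBundleTwo n p) ψ₂) <
            zSlope (centralCharge φ (lineBundleOne n p) ψ₁)) ∧
          0 < (centralCharge φ (lineBundleTwo n p) ψ₂).im ∧
          0 < (centralCharge φ (lineBundleOne n p).shift ψ₁).im ∧
          (b < 1 ↔ (centralCharge φ (lineBundleTwo n p) ψ₂).arg <
            (centralCharge φ (lineBundleOne n p).shift ψ₁).arg)) := by
  have hn0 : n ≠ 0 := by omega
  refine ⟨fun hp hp0 => ?_, fun hp0 hp => ?_⟩
  · filter_upwards [eventually_position_conjCharge hn hp hp0] with b hb φ hφ ψ₁ hψ₁ ψ₂ hψ₂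
    obtain ⟨h2re, h2im, h1re, h1im, hiff⟩ := hb
    rw [centralCharge_shift, centralCharge_lineBundleOne hn0 hφ hψ₁,
      centralCharge_lineBundleTwo hn0 hφ hψ₂]
    set z := conjChargeOne n p b
    set w := conjChargeTwo n p b
    have i1 : 0 < ((starRingEnd ℂ) z).im := by rw [Complex.conj_im]; linarith
    have i2 : 0 < (-(starRingEnd ℂ) w).im := by
      rw [Complex.neg_im, Complex.conj_im]; linarith
    refine ⟨h1re.ne, h2re.ne', ?_, i1, i2, ?_⟩
    · rw [hiff, zSlope_lt_zSlope_iff_of_neg_of_pos (by simpa using h1re) (by simpa using h2re)]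
      simp only [Complex.conj_re, Complex.conj_im]
      constructor <;> intro h <;> linarith
    · rw [hiff, arg_lt_arg_iff_of_im_pos i1 i2]
      simp only [Complex.conj_re, Complex.conj_im, Complex.neg_re, Complex.neg_im]
      constructor <;> intro h <;> linarith
  · -- The charges at `p` are the complex conjugates of the charges at `-p < 0`.
    obtain ⟨p, rfl⟩ : ∃ p', p = -p' := ⟨-p, (neg_neg p).symm⟩
    have hp0 : p < 0 := by linarith
    filter_upwards [eventually_position_conjCharge hn
      (hp.imp_right fun h => by linarith) hp0] with b hb φ hφ ψ₁ hψ₁ ψ₂ hψ₂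
    obtain ⟨h2re, h2im, h1re, h1im, hiff⟩ := hb
    rw [centralCharge_shift, centralCharge_lineBundleOne hn0 hφ hψ₁,
      centralCharge_lineBundleTwo hn0 hφ hψ₂, conjChargeOne_neg hp0, conjChargeTwo_neg hp0,
      Complex.conj_conj, Complex.conj_conj]
    set z := conjChargeOne n p b
    set w := conjChargeTwo n p b
    have i1 : 0 < (-z).im := by rw [Complex.neg_im]; linarith
    refine ⟨h1re.ne, h2re.ne', ?_, h2im, i1, ?_⟩
    · rw [hiff, zSlope_lt_zSlope_iff_of_pos_of_neg h2re h1re]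
      constructor <;> intro h <;> linarith
    · rw [hiff, arg_lt_arg_iff_of_im_pos h2im i1]
      simp only [Complex.neg_re, Complex.neg_im]
      constructor <;> intro h <;> linarith
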